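/- Let $d\ge 1$ and $r\ge 1$, let $(X,\Sigma,\mu)$ be a probability space whose underlying measurable space is standard Borel, and let $T_1,\dots,T_d:\mathbb{Z}^r\curvearrowright (X,\Sigma,\mu)$ be commuting probability-preserving actions, i.e. each $T_i^n$ ($n\in\mathbb{Z}^r$) is a measurable $\mu$-preserving transformation of $X$, $T_i^0=\mathrm{id}$, $T_i^{m+n}=T_i^m\circ T_i^n$, and $T_i^m\circ T_j^n=T_j^n\circ T_i^m$ for all $i\neq j$ and $m,n\in\mathbb{Z}^r$. Let $f_1,\dots,f_d\in L^\infty(\mu)$ (real- or complex-valued). Then there is a function $F\in L^2(\mu)$ such that, for every Følner sequence $(I_N)_{N\ge1}$ of finite subsets of $\mathbb{Z}^r$ (that is, $I_N\ne\emptyset$ for all large $N$ and $|(I_N+g)\,\triangle\, I_N|/|I_N|\to0$ as $N\to\infty$ for every $g\in\mathbb{Z}^r$) and every sequence $(a_N)_{N\ge1}$ of points of $\mathbb{Z}^r$, $$\frac{1}{|I_N|}\sum_{n\in I_N+a_N}\ \prod_{i=1}^d f_i\circ T_i^n\ \longrightarrow\ F\qquad\text{in } L^2(\mu)\text{ as }N\to\infty.$$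 In particular the limit does not depend on the choice of $(I_N)_{N\ge1}$ or $(a_N)_{N\ge1}$. -/

import Mathlib

open MeasureTheory Filter Topology
open scoped Pointwise ENNReal

/-- A (pointwise, measurable) action `n ↦ T n` of the additive group `G` on `X` by
transformations preserving the measure `μ`. For an action of a group every `T n` is automatically
invertible with inverse `T (-n)`. -/
structure IsMeasurePreservingAction {G X : Type*} [AddGroup G] [MeasurableSpace X]
    (μ : Measure X) (T : G → X → X) : Prop where
  map_zero : ∀ x, T 0 x = x
  map_add : ∀ m n x, T (m + n) x = T m (T n x)
  measurePreserving : ∀ n, MeasurePreserving (T n) μ μ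

/-- The nonconventional average
`x ↦ |I|⁻¹ ∑ n ∈ I + a, ∏ i, f i (T i n x)` over the translate `I + a` of the finite set `I`. -/
noncomputable def nonconventionalAverage {𝕜 : Type*} [RCLike 𝕜] {X : Type*} {r d : ℕ}
    (T : Fin d → (Fin r → ℤ) → X → X) (f : Fin d → X → 𝕜)
    (I : Finset (Fin r → ℤ)) (a : Fin r → ℤ) (x : X) : 𝕜 :=
  (I.card : 𝕜)⁻¹ * ∑ n ∈ I + {a}, ∏ i, f i (T i n x)

/-!
The averages converge for a reason that only involves the geometry of `L²`, combined with an
induction on the number of actions.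

Fix all functions but the first, and let `Φ_I` be the operator on `L²` which sends the first
function to the average over `I`. The vectors `h` for which `Φ_I h` is Cauchy along the Følner
filter form a closed subspace `W`. If `h ⟂ W`, and if every weak limit of `Φ_I† Φ_I a` lies in `W`,
then `⟪Φ_I h, Φ_I a⟫ = ⟪h, Φ_I† Φ_I a⟫` tends to `0` for all `a`, hence `Φ_I h → 0`, so that `h ∈ W`
and `h = 0`; thus `W` is everything (`cauchy_of_adjoint_comp`). It remains to see that `Φ_J`
converges on the weak limits of `Φ_I† Φ_I a`. Writing `S` for the first action, `T i` for the others
and `g = Φ_I a`, one has `Φ_I† g = avg_{m ∈ I} S (-m) (g * ∏ i, star (T i m (f i)))`, and the change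
of variable `m ↦ m + n` gives
`Φ_J Φ_I† g ≈ avg_{m ∈ I} S (-m) g * avg_{n ∈ J} ∏ i, T i n (f i * S (-m) (star (T i m (f i))))`
(`norm_averageOperator_averageAdjoint_sub_le`), where `g` is bounded uniformly in `I` and the inner
averages involve one action fewer.

The convergence of the inner averages is needed on average over `m`. It is obtained by applying the
induction hypothesis to the bounded families `G → A` of functions, on which the limit along an
ultrafilter of averages over `m ∈ I` of the given mean is again a mean (`isSystem_meanAlong`).
Such a mean need not be countably additive, so the induction `IsSystem.cauchy_multipleAverage` is
carried out for invariant means on normed commutative star algebras. The theorem is the case of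
integration on the algebra of bounded measurable functions. Convergence is proved along the filter
`foelnerFilter` of all asymptotically invariant finite sets, which explains why the limit is the
same for all Følner sequences and all translates.
-/

/-! ### Vectors of convergence in Hilbert space -/

/-- A bounded family of scalars converges along every ultrafilter. -/
theorem Ultrafilter.exists_tendsto_of_norm_le {𝕜 κ : Type*} [RCLike 𝕜] (U : Ultrafilter κ)
    {u : κ → 𝕜} {C : ℝ} (hu : ∀ k, ‖u k‖ ≤ C) : ∃ x, Tendsto u U (𝓝 x) := by
  obtain ⟨x, -, hx⟩ := (isCompact_closedBall (0 : 𝕜) C).ultrafilter_le_nhds (U.map u)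
    (by
      rw [le_principal_iff]
      exact Filter.mem_map.2 (Filter.univ_mem' fun k => by simpa using hu k))
  exact ⟨x, hx⟩

section Hilbert

variable {𝕜 H κ : Type*} [RCLike 𝕜] [NormedAddCommGroup H] [InnerProductSpace 𝕜 H]

/-- A bounded family in a Hilbert space converges weakly along every ultrafilter. -/
theorem Ultrafilter.exists_weak_limit [CompleteSpace H] (U : Ultrafilter κ) {u : κ → H} {C : ℝ}
    (hu : ∀ k, ‖u k‖ ≤ C) :
    ∃ σ : H, ∀ h : H, Tendsto (fun k => inner 𝕜 h (u k)) U (𝓝 (inner 𝕜 h σ)) := by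
  have hb : ∀ h k, ‖inner 𝕜 (u k) h‖ ≤ C * ‖h‖ := fun h k =>
    (norm_inner_le_norm _ _).trans (mul_le_mul_of_nonneg_right (hu k) (norm_nonneg _))
  choose ℓ hℓ using fun h => U.exists_tendsto_of_norm_le (hb h)
  let L : H →ₗ[𝕜] 𝕜 :=
    { toFun := ℓ
      map_add' := fun x y => tendsto_nhds_unique (hℓ (x + y)) (by
        simpa only [inner_add_right] using (hℓ x).add (hℓ y))
      map_smul' := fun c x => tendsto_nhds_unique (hℓ (c • x)) (by
        simpa only [inner_smul_right, RingHom.id_apply, smul_eq_mul] using (hℓ x).const_mul c) }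
  let L' : H →L[𝕜] 𝕜 := L.mkContinuous C fun h =>
    le_of_tendsto (hℓ h).norm (Eventually.of_forall (hb h))
  refine ⟨(InnerProductSpace.toDual 𝕜 H).symm L', fun h => ?_⟩
  have h1 : inner 𝕜 ((InnerProductSpace.toDual 𝕜 H).symm L') h = ℓ h := by
    rw [InnerProductSpace.toDual_symm_apply]; rfl
  rw [← inner_conj_symm, h1]
  have h2 := (RCLike.continuous_conj (K := 𝕜)).continuousAt.tendsto.comp (hℓ h)
  refine h2.congr fun k => ?_
  simp

/-- The submodule of vectors `h` along which a uniformly bounded family of operators is Cauchy. -/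
def cauchySubmodule (Φ : κ → H →L[𝕜] H) (l : Filter κ) : Submodule 𝕜 H where
  carrier := {h | ∀ ε > 0, ∀ᶠ p in l ×ˢ l, ‖Φ p.1 h - Φ p.2 h‖ ≤ ε}
  zero_mem' := fun ε hε => Eventually.of_forall fun p => by simpa using hε.le
  add_mem' := fun {x y} hx hy ε hε => by
    filter_upwards [hx (ε / 2) (half_pos hε), hy (ε / 2) (half_pos hε)] with p h1 h2
    rw [map_add, map_add, add_sub_add_comm]
    exact (norm_add_le _ _).trans (by linarith)
  smul_mem' := fun c x hx ε hε => by
    have hc : 0 < ‖c‖ + 1 := by positivity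
    filter_upwards [hx (ε / (‖c‖ + 1)) (div_pos hε hc)] with p h1
    rw [map_smul, map_smul, ← smul_sub, norm_smul]
    calc ‖c‖ * ‖Φ p.1 x - Φ p.2 x‖ ≤ (‖c‖ + 1) * (ε / (‖c‖ + 1)) := by gcongr; linarith
      _ = ε := by field_simp

theorem mem_cauchySubmodule {Φ : κ → H →L[𝕜] H} {l : Filter κ} {h : H} :
    h ∈ cauchySubmodule Φ l ↔ ∀ ε > 0, ∀ᶠ p in l ×ˢ l, ‖Φ p.1 h - Φ p.2 h‖ ≤ ε := Iff.rfl

theorem isClosed_cauchySubmodule {Φ : κ → H →L[𝕜] H} {C : ℝ} (hΦ : ∀ k h, ‖Φ k h‖ ≤ C * ‖h‖)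
    (l : Filter κ) : IsClosed (cauchySubmodule Φ l : Set H) := by
  refine isClosed_of_closure_subset fun h hh => ?_
  intro ε hε
  have hC : 0 < |C| + 1 := by positivity
  obtain ⟨y, hy, hyh⟩ := Metric.mem_closure_iff.1 hh (ε / (3 * (|C| + 1))) (by positivity)
  have hb : ∀ k, ‖Φ k (h - y)‖ ≤ ε / 3 := fun k => by
    calc ‖Φ k (h - y)‖ ≤ C * ‖h - y‖ := hΦ _ _
      _ ≤ (|C| + 1) * (ε / (3 * (|C| + 1))) := by
        rw [← dist_eq_norm]
        have := le_abs_self C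
        gcongr
        linarith
      _ = ε / 3 := by field_simp
  filter_upwards [hy (ε / 3) (by positivity)] with p hp
  have e : Φ p.1 h - Φ p.2 h = Φ p.1 (h - y) + (Φ p.1 y - Φ p.2 y) - Φ p.2 (h - y) := by
    simp only [map_sub]; abel
  rw [e]
  refine (norm_sub_le _ _).trans ?_
  have := norm_add_le (Φ p.1 (h - y)) (Φ p.1 y - Φ p.2 y)
  linarith [hb p.1, hb p.2]

/-- **Structure versus randomness.** If the vectors `(Φ k)† (Φ k a)` are asymptotically vectors of
convergence, then every vector is a vector of convergence: a vector `h` orthogonal to all vectors of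
convergence is orthogonal to the weak limits of `(Φ k)† (Φ k a)`, whence `Φ k h → 0`. -/
theorem cauchy_of_adjoint_comp [CompleteSpace H] {Φ : κ → H →L[𝕜] H} {C : ℝ}
    (hΦ : ∀ k h, ‖Φ k h‖ ≤ C * ‖h‖) (hC : 0 ≤ C) {l : Filter κ} {V : Set H} (hV : Dense V)
    (hyp : ∀ a ∈ V, ∀ U : Ultrafilter κ, ↑U ≤ l → ∀ ε > 0, ∀ᶠ p in l ×ˢ l, ∀ᶠ k in (U : Filter κ),
      ‖Φ p.1 ((Φ k).adjoint (Φ k a)) - Φ p.2 ((Φ k).adjoint (Φ k a))‖ ≤ ε) (h : H) :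
    ∀ ε > 0, ∀ᶠ p in l ×ˢ l, ‖Φ p.1 h - Φ p.2 h‖ ≤ ε := by
  have hcl := isClosed_cauchySubmodule hΦ l
  have hcomp : CompleteSpace (cauchySubmodule Φ l) := hcl.completeSpace_coe
  suffices htop : cauchySubmodule Φ l = ⊤ by
    rw [← mem_cauchySubmodule, htop]; trivial
  rw [← Submodule.orthogonal_eq_bot_iff, Submodule.eq_bot_iff]
  intro h hh
  have hnorm : ∀ k, ‖Φ k‖ ≤ C := fun k => (Φ k).opNorm_le_bound hC (hΦ k)
  have hadj : ∀ k x, ‖(Φ k).adjoint x‖ ≤ C * ‖x‖ := fun k x =>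
    ((Φ k).adjoint.le_opNorm x).trans (by
      rw [LinearIsometryEquiv.norm_map]
      exact mul_le_mul_of_nonneg_right (hnorm k) (norm_nonneg _))
  have hlim : Tendsto (fun k => Φ k h) l (𝓝 0) := by
    rw [tendsto_iff_ultrafilter]
    intro U hU
    have horth : ∀ a ∈ V, Tendsto (fun k => inner 𝕜 (Φ k h) (Φ k a)) U (𝓝 0) := by
      intro a ha
      obtain ⟨σ, hσ⟩ := U.exists_weak_limit (𝕜 := 𝕜) (u := fun k => (Φ k).adjoint (Φ k a))
        (C := C * (C * ‖a‖)) fun k => (hadj k _).trans (mul_le_mul_of_nonneg_left (hΦ k a) hC)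
      have hmem : σ ∈ cauchySubmodule Φ l := by
        intro ε hε
        filter_upwards [hyp a ha U hU ε hε] with p hp
        set D := Φ p.1 - Φ p.2 with hD
        have key : ‖inner 𝕜 (D σ) (D σ)‖ ≤ ‖D σ‖ * ε := by
          have h1 := (hσ (D.adjoint (D σ))).norm
          rw [ContinuousLinearMap.adjoint_inner_left] at h1
          refine le_of_tendsto h1 ?_
          filter_upwards [hp] with k hk
          rw [ContinuousLinearMap.adjoint_inner_left]
          exact (norm_inner_le_norm _ _).trans (mul_le_mul_of_nonneg_left hk (norm_nonneg _))
        rw [inner_self_eq_norm_sq_to_K, norm_pow, RCLike.norm_ofReal, abs_norm, sq] at key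
        change ‖D σ‖ ≤ ε
        rcases (norm_nonneg (D σ)).eq_or_lt with h0 | h0
        · rw [← h0]; exact hε.le
        · exact le_of_mul_le_mul_left key h0
      have h0 : inner 𝕜 h σ = 0 := Submodule.inner_left_of_mem_orthogonal hmem hh
      have h1 := hσ h
      rw [h0] at h1
      refine h1.congr fun k => ?_
      rw [ContinuousLinearMap.adjoint_inner_right]
    rw [tendsto_zero_iff_norm_tendsto_zero, Metric.tendsto_nhds]
    intro ε hε
    -- Approximate `h` by `a ∈ V` well enough to absorb the error in `‖Φ k h‖²`.
    set M := C * ‖h‖ * C + 1 with hM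
    have hMpos : 0 < M := by positivity
    obtain ⟨a, ha, hah⟩ := Metric.mem_closure_iff.1 (hV h) (ε ^ 2 / (2 * M)) (by positivity)
    filter_upwards [Metric.tendsto_nhds.1 (horth a ha) (ε ^ 2 / 2) (by positivity)] with k hk
    rw [dist_zero_right] at hk
    rw [dist_zero_right, norm_norm]
    refine lt_of_pow_lt_pow_left₀ 2 hε.le ?_
    have e : ‖Φ k h‖ ^ 2 = ‖inner 𝕜 (Φ k h) (Φ k h)‖ := by
      rw [inner_self_eq_norm_sq_to_K, norm_pow, RCLike.norm_ofReal, abs_norm]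
    have e2 : inner 𝕜 (Φ k h) (Φ k h)
        = inner 𝕜 (Φ k h) (Φ k a) + inner 𝕜 (Φ k h) (Φ k (h - a)) := by
      rw [← inner_add_right, ← map_add]; congr 3; abel
    have e3 : ‖inner 𝕜 (Φ k h) (Φ k (h - a))‖ ≤ ε ^ 2 / 2 := by
      calc _ ≤ ‖Φ k h‖ * ‖Φ k (h - a)‖ := norm_inner_le_norm _ _
        _ ≤ (C * ‖h‖) * (C * ‖h - a‖) := by gcongr <;> exact hΦ _ _
        _ = (C * ‖h‖ * C) * ‖h - a‖ := by ring
        _ ≤ M * (ε ^ 2 / (2 * M)) := by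
          rw [← dist_eq_norm]
          gcongr
          linarith
        _ = ε ^ 2 / 2 := by field_simp
    rw [e, e2]
    exact (norm_add_le _ _).trans_lt (by linarith)
  have hmem : h ∈ cauchySubmodule Φ l := by
    intro ε hε
    have h1 : Tendsto (fun p : κ × κ => Φ p.1 h - Φ p.2 h) (l ×ˢ l) (𝓝 0) := by
      simpa using (hlim.comp tendsto_fst).sub (hlim.comp tendsto_snd)
    filter_upwards [Metric.tendsto_nhds.1 h1 ε hε] with p hp
    exact (by simpa using hp : ‖Φ p.1 h - Φ p.2 h‖ < ε).le
  exact inner_self_eq_zero.1 (Submodule.inner_right_of_mem_orthogonal hmem hh)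

end Hilbert

/-- The version of `cauchy_of_adjoint_comp` for a space with a semi-inner product, obtained by
passing to its completion. -/
theorem cauchy_of_formal_adjoint_comp {𝕜 E κ : Type*} [RCLike 𝕜] [SeminormedAddCommGroup E]
    [InnerProductSpace 𝕜 E] {Φ : κ → E →ₗ[𝕜] E} {Ψ : κ → E → E} {C : ℝ} (hC : 0 ≤ C)
    (hΦ : ∀ k a, ‖Φ k a‖ ≤ C * ‖a‖) (hadj : ∀ k a b, inner 𝕜 (Φ k a) b = inner 𝕜 a (Ψ k b))
    {l : Filter κ}
    (hyp : ∀ a, ∀ U : Ultrafilter κ, ↑U ≤ l → ∀ ε > 0, ∀ᶠ p in l ×ˢ l, ∀ᶠ k in (U : Filter κ),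
      ‖Φ p.1 (Ψ k (Φ k a)) - Φ p.2 (Ψ k (Φ k a))‖ ≤ ε) (a : E) :
    ∀ ε > 0, ∀ᶠ p in l ×ˢ l, ‖Φ p.1 a - Φ p.2 a‖ ≤ ε := by
  let Φc : κ → UniformSpace.Completion E →L[𝕜] UniformSpace.Completion E := fun k =>
    ((Φ k).mkContinuous C (hΦ k)).completion
  have hco : ∀ k (x : E), Φc k x = (Φ k x : E) := fun k x => by
    simp only [Φc, ContinuousLinearMap.completion_apply_coe]; rfl
  have hbd : ∀ k h, ‖Φc k h‖ ≤ C * ‖h‖ := fun k h => by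
    induction h using UniformSpace.Completion.induction_on with
    | hp => exact isClosed_le (by fun_prop) (by fun_prop)
    | ih x =>
      rw [hco, UniformSpace.Completion.norm_coe, UniformSpace.Completion.norm_coe]
      exact hΦ k x
  have had : ∀ k (b : E), (Φc k).adjoint b = (Ψ k b : E) := fun k b => by
    refine ext_inner_left 𝕜 fun v => ?_
    rw [ContinuousLinearMap.adjoint_inner_right]
    induction v using UniformSpace.Completion.induction_on with
    | hp => exact isClosed_eq (by fun_prop) (by fun_prop)
    | ih x =>
      rw [hco, UniformSpace.Completion.inner_coe, UniformSpace.Completion.inner_coe, hadj]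
  have main := cauchy_of_adjoint_comp (l := l) hbd hC
    (V := Set.range ((↑) : E → UniformSpace.Completion E))
    UniformSpace.Completion.denseRange_coe (by
      rintro _ ⟨a, rfl⟩ U hU ε hε
      filter_upwards [hyp a U hU ε hε] with p hp
      filter_upwards [hp] with k hk
      rw [hco, had, hco, hco, ← UniformSpace.Completion.coe_sub, UniformSpace.Completion.norm_coe]
      exact hk) (a : UniformSpace.Completion E)
  intro ε hε
  filter_upwards [main ε hε] with p hp
  rwa [hco, hco, ← UniformSpace.Completion.coe_sub, UniformSpace.Completion.norm_coe] at hp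

/-! ### Averages over finite sets and the Følner filter -/

section Average

open scoped symmDiff

/-- The average of `u` over the finite set `I`; it is `0` if `I` is empty. -/
noncomputable def finsetAverage (𝕜 : Type*) {G E : Type*} [RCLike 𝕜] [AddCommGroup E] [Module 𝕜 E]
    (I : Finset G) (u : G → E) : E :=
  (I.card : 𝕜)⁻¹ • ∑ n ∈ I, u n

/-- The relative size of the symmetric difference of `I` and its translate `I + g`. -/
noncomputable def translationDefect {G : Type*} [AddCommGroup G] (g : G) (I : Finset G) : ℝ :=
  (Set.ncard (((g +ᵥ (I : Set G)) ∆ (I : Set G)) : Set G) : ℝ) / I.card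

/-- The filter of asymptotically invariant nonempty finite subsets of `G`: a sequence of
finite sets tends to it precisely when it is a Følner sequence. -/
noncomputable def foelnerFilter (G : Type*) [AddCommGroup G] : Filter (Finset G) :=
  𝓟 {I | I.Nonempty} ⊓ ⨅ g : G, comap (translationDefect g) (𝓝 0)

variable {𝕜 G E F : Type*} [RCLike 𝕜]

theorem finsetAverage_add [AddCommGroup E] [Module 𝕜 E] (I : Finset G) (u v : G → E) :
    finsetAverage 𝕜 I (fun n => u n + v n) = finsetAverage 𝕜 I u + finsetAverage 𝕜 I v := by
  simp [finsetAverage, Finset.sum_add_distrib]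

theorem finsetAverage_sub [AddCommGroup E] [Module 𝕜 E] (I : Finset G) (u v : G → E) :
    finsetAverage 𝕜 I (fun n => u n - v n) = finsetAverage 𝕜 I u - finsetAverage 𝕜 I v := by
  simp [finsetAverage, Finset.sum_sub_distrib, smul_sub]

theorem finsetAverage_smul [AddCommGroup E] [Module 𝕜 E] (I : Finset G) (c : 𝕜) (u : G → E) :
    finsetAverage 𝕜 I (fun n => c • u n) = c • finsetAverage 𝕜 I u := by
  simp [finsetAverage, ← Finset.smul_sum, smul_comm c]

theorem map_finsetAverage [AddCommGroup E] [Module 𝕜 E] [AddCommGroup F] [Module 𝕜 F]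
    {L : Type*} [FunLike L E F] [LinearMapClass L 𝕜 E F] (f : L) (I : Finset G) (u : G → E) :
    f (finsetAverage 𝕜 I u) = finsetAverage 𝕜 I (fun n => f (u n)) := by
  simp [finsetAverage]

theorem finsetAverage_mul [CommRing E] [Algebra 𝕜 E] (I : Finset G) (u : G → E) (b : E) :
    finsetAverage 𝕜 I u * b = finsetAverage 𝕜 I (fun n => u n * b) := by
  simp [finsetAverage, Finset.sum_mul]

theorem mul_finsetAverage [CommRing E] [Algebra 𝕜 E] (I : Finset G) (u : G → E) (b : E) :
    b * finsetAverage 𝕜 I u = finsetAverage 𝕜 I (fun n => b * u n) := by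
  simp [finsetAverage, Finset.mul_sum]

theorem finsetAverage_comm [AddCommGroup E] [Module 𝕜 E] (I J : Finset G) (u : G → G → E) :
    finsetAverage 𝕜 I (fun m => finsetAverage 𝕜 J (u m))
      = finsetAverage 𝕜 J (fun n => finsetAverage 𝕜 I fun m => u m n) := by
  simp only [finsetAverage, ← Finset.smul_sum]
  rw [Finset.sum_comm, smul_comm]

theorem norm_finsetAverage_le_average [SeminormedAddCommGroup E] [NormedSpace 𝕜 E] (I : Finset G)
    (u : G → E) : ‖finsetAverage 𝕜 I u‖ ≤ finsetAverage ℝ I fun n => ‖u n‖ := by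
  simp only [finsetAverage, norm_smul, norm_inv, RCLike.norm_natCast, smul_eq_mul]
  gcongr
  exact norm_sum_le _ _

theorem finsetAverage_mono {I : Finset G} {u v : G → ℝ} (h : ∀ n ∈ I, u n ≤ v n) :
    finsetAverage ℝ I u ≤ finsetAverage ℝ I v := by
  simp only [finsetAverage, smul_eq_mul]
  gcongr with n hn
  exact h n hn

theorem finsetAverage_const_le (I : Finset G) {C : ℝ} (hC : 0 ≤ C) :
    finsetAverage ℝ I (fun _ => C) ≤ C := by
  rcases I.eq_empty_or_nonempty with rfl | h
  · simpa [finsetAverage] using hC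
  · have : (I.card : ℝ) ≠ 0 := by exact_mod_cast h.card_pos.ne'
    simp [finsetAverage, this]

theorem norm_finsetAverage_le [SeminormedAddCommGroup E] [NormedSpace 𝕜 E] {I : Finset G}
    {u : G → E} {C : ℝ} (hC : 0 ≤ C) (h : ∀ n, ‖u n‖ ≤ C) : ‖finsetAverage 𝕜 I u‖ ≤ C :=
  (norm_finsetAverage_le_average I u).trans <|
    (finsetAverage_mono fun n _ => h n).trans (finsetAverage_const_le I hC)

theorem sq_finsetAverage_le (I : Finset G) (u : G → ℝ) :
    finsetAverage ℝ I u ^ 2 ≤ finsetAverage ℝ I fun n => u n ^ 2 := by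
  rcases I.eq_empty_or_nonempty with rfl | h
  · simp [finsetAverage]
  · have hc : (0 : ℝ) < I.card := by exact_mod_cast h.card_pos
    have h1 := sq_sum_le_card_mul_sum_sq (s := I) (f := u)
    simp only [finsetAverage, smul_eq_mul, mul_pow]
    calc ((I.card : ℝ)⁻¹) ^ 2 * (∑ n ∈ I, u n) ^ 2
        ≤ ((I.card : ℝ)⁻¹) ^ 2 * (I.card * ∑ n ∈ I, u n ^ 2) := by gcongr
      _ = (I.card : ℝ)⁻¹ * ∑ n ∈ I, u n ^ 2 := by field_simp

variable [AddCommGroup G]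

theorem translationDefect_nonneg (g : G) (I : Finset G) : 0 ≤ translationDefect g I := by
  unfold translationDefect; positivity

theorem tendsto_translationDefect (g : G) :
    Tendsto (translationDefect g) (foelnerFilter G) (𝓝 0) :=
  (tendsto_iff_comap.2 (iInf_le _ g)).mono_left inf_le_right

/-- Shifting the argument changes an average of bounded quantities by at most the bound times the
translation defect. -/
theorem norm_finsetAverage_shift_sub_le [SeminormedAddCommGroup E] [NormedSpace 𝕜 E]
    (I : Finset G) (g : G) {u : G → E} {C : ℝ} (h : ∀ n, ‖u n‖ ≤ C) :
    ‖finsetAverage 𝕜 I (fun n => u (g + n)) - finsetAverage 𝕜 I u‖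
      ≤ translationDefect g I * C := by
  classical
  have hshift : ∑ n ∈ I, u (g + n) = ∑ n ∈ (g +ᵥ I), u n := by
    rw [← Finset.image_vadd, Finset.sum_image (fun x _ y _ hxy => by simpa using hxy)]
    simp
  have hcard : translationDefect g I = (((g +ᵥ I) ∆ I).card : ℝ) / I.card := by
    rw [translationDefect, ← Finset.coe_vadd_finset, ← Finset.coe_symmDiff, Set.ncard_coe_finset]
  have hdiff : ∑ n ∈ (g +ᵥ I), u n - ∑ n ∈ I, u n
      = ∑ n ∈ (g +ᵥ I) \ I, u n - ∑ n ∈ I \ (g +ᵥ I), u n := by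
    rw [Finset.sum_sdiff_sub_sum_sdiff]
  have hle : ‖∑ n ∈ (g +ᵥ I), u n - ∑ n ∈ I, u n‖ ≤ ((g +ᵥ I) ∆ I).card * C := by
    rw [hdiff]
    refine (norm_sub_le _ _).trans ?_
    have h1 : ∀ s : Finset G, ‖∑ n ∈ s, u n‖ ≤ s.card * C := fun s => by
      simpa using norm_sum_le_of_le s (f := u) (n := fun _ => C) fun n _ => h n
    have h2 : ((g +ᵥ I) ∆ I).card = ((g +ᵥ I) \ I).card + (I \ (g +ᵥ I)).card := by
      rw [symmDiff_def, Finset.sup_eq_union, Finset.card_union_of_disjoint]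
      exact disjoint_sdiff_sdiff
    rw [h2]
    push_cast
    linarith [h1 ((g +ᵥ I) \ I), h1 (I \ (g +ᵥ I))]
  simp only [finsetAverage]
  rw [hshift, ← smul_sub, norm_smul, norm_inv, RCLike.norm_natCast, hcard]
  calc (I.card : ℝ)⁻¹ * _ ≤ (I.card : ℝ)⁻¹ * (((g +ᵥ I) ∆ I).card * C) := by gcongr
    _ = _ := by ring

end Average

/-! ### Systems and their `L²` spaces -/

section System

/-- The properties of integration against a probability measure, for an algebra `A` of bounded
functions with the supremum norm, on which the construction of `L²` relies. -/
structure IsMean {𝕜 A : Type*} [RCLike 𝕜] [NormedCommRing A] [StarRing A] [NormedAlgebra 𝕜 A]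
    (φ : A →ₗ[𝕜] 𝕜) : Prop where
  map_star : ∀ a, φ (star a) = starRingEnd 𝕜 (φ a)
  re_nonneg : ∀ a, 0 ≤ RCLike.re (φ (star a * a))
  mul_le : ∀ a b, RCLike.re (φ (star (a * b) * (a * b))) ≤ ‖a‖ ^ 2 * RCLike.re (φ (star b * b))
  norm_le : ∀ a, ‖φ a‖ ≤ ‖a‖

/-- An algebraic model of `d` commuting probability-preserving actions of `G`: a mean `φ` on an
algebra `A` of bounded functions, and commuting actions `T i` of `G` on `A` by contractive
automorphisms preserving `φ`. No countable additivity is required, so that the class of systems is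
closed under the ultraproduct-like construction `meanAlong`. -/
structure IsSystem {𝕜 A G : Type*} [RCLike 𝕜] [NormedCommRing A] [StarRing A] [NormedAlgebra 𝕜 A]
    [AddCommGroup G] {d : ℕ} (φ : A →ₗ[𝕜] 𝕜) (T : Fin d → G → A →⋆ₐ[𝕜] A) : Prop
    extends IsMean φ where
  apply_zero : ∀ i a, T i 0 a = a
  apply_add : ∀ i m n a, T i (m + n) a = T i m (T i n a)
  comm : ∀ i j m n a, T i m (T j n a) = T j n (T i m a)
  norm_map_le : ∀ i n a, ‖T i n a‖ ≤ ‖a‖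
  invariant : ∀ i n a, φ (T i n a) = φ a

/-- The multiple ergodic average of `f` along `T` over the finite set `I`. -/
noncomputable def multipleAverage {𝕜 A G : Type*} [RCLike 𝕜] [NormedCommRing A] [StarRing A]
    [NormedAlgebra 𝕜 A] {d : ℕ} (T : Fin d → G → A →⋆ₐ[𝕜] A) (f : Fin d → A)
    (I : Finset G) : A :=
  finsetAverage 𝕜 I fun n => ∏ i, T i n (f i)

variable {𝕜 A G : Type*} [RCLike 𝕜] [NormedCommRing A] [StarRing A] [NormedAlgebra 𝕜 A]
variable {φ : A →ₗ[𝕜] 𝕜}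

theorem IsSystem.tail [AddCommGroup G] {d : ℕ} {T : Fin (d + 1) → G → A →⋆ₐ[𝕜] A}
    (h : IsSystem φ T) : IsSystem φ (fun i : Fin d => T i.succ) where
  toIsMean := h.toIsMean
  apply_zero i := h.apply_zero i.succ
  apply_add i := h.apply_add i.succ
  comm i j := h.comm i.succ j.succ
  norm_map_le i := h.norm_map_le i.succ
  invariant i := h.invariant i.succ

theorem IsSystem.norm_prod_le [NormOneClass A] [AddCommGroup G] {d : ℕ}
    {T : Fin d → G → A →⋆ₐ[𝕜] A} (h : IsSystem φ T) (f : Fin d → A) (n : G) :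
    ‖∏ i, T i n (f i)‖ ≤ ∏ i, ‖f i‖ :=
  (Finset.norm_prod_le _ _).trans <|
    Finset.prod_le_prod (fun _ _ => norm_nonneg _) fun i _ => h.norm_map_le i n _

set_option linter.unusedVariables false in
/-- The algebra `A` regarded as a space with the semi-inner product `φ (star a * b)`: the `L²`
space of `φ` before completion. -/
@[nolint unusedArguments]
def PreL2 {φ : A →ₗ[𝕜] 𝕜} (hφ : IsMean φ) : Type _ := A

instance (hφ : IsMean φ) : AddCommGroup (PreL2 hφ) := inferInstanceAs (AddCommGroup A)
instance (hφ : IsMean φ) : Module 𝕜 (PreL2 hφ) := inferInstanceAs (Module 𝕜 A)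

/-- The identity map from `A` to its `L²` space. -/
def toPreL2 (hφ : IsMean φ) : A ≃ₗ[𝕜] PreL2 hφ := LinearEquiv.refl 𝕜 A

variable [StarModule 𝕜 A]

/-- The semi-inner product `φ (star a * b)`. -/
noncomputable abbrev preL2Core (hφ : IsMean φ) : PreInnerProductSpace.Core 𝕜 (PreL2 hφ) where
  inner a b := φ (star ((toPreL2 hφ).symm a) * (toPreL2 hφ).symm b)
  conj_inner_symm a b := by rw [← hφ.map_star, star_mul, star_star]
  re_inner_nonneg a := hφ.re_nonneg _
  add_left a b c := by rw [map_add, star_add, add_mul, map_add]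
  smul_left a b c := by simp

noncomputable instance (hφ : IsMean φ) : SeminormedAddCommGroup (PreL2 hφ) :=
  InnerProductSpace.Core.toSeminormedAddCommGroup (c := preL2Core hφ)

noncomputable instance (hφ : IsMean φ) : InnerProductSpace 𝕜 (PreL2 hφ) :=
  InnerProductSpace.ofCore (preL2Core hφ)

theorem inner_toPreL2 (hφ : IsMean φ) (a b : A) :
    inner 𝕜 (toPreL2 hφ a) (toPreL2 hφ b) = φ (star a * b) := rfl

theorem norm_toPreL2_sq (hφ : IsMean φ) (a : A) :
    ‖toPreL2 hφ a‖ ^ 2 = RCLike.re (φ (star a * a)) := by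
  rw [← inner_toPreL2 hφ, inner_self_eq_norm_sq]

theorem norm_toPreL2_mul_le (hφ : IsMean φ) (a b : A) :
    ‖toPreL2 hφ (a * b)‖ ≤ ‖a‖ * ‖toPreL2 hφ b‖ := by
  refine (sq_le_sq₀ (norm_nonneg _) (by positivity)).1 ?_
  rw [mul_pow, norm_toPreL2_sq, norm_toPreL2_sq]
  exact hφ.mul_le a b

theorem norm_toPreL2_le (hφ : IsMean φ) (a : A) :
    ‖toPreL2 hφ a‖ ≤ ‖a‖ * ‖toPreL2 hφ 1‖ := by
  simpa using norm_toPreL2_mul_le hφ a 1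

theorem IsSystem.norm_toPreL2_map [AddCommGroup G] {d : ℕ} {T : Fin d → G → A →⋆ₐ[𝕜] A}
    (h : IsSystem φ T) (i : Fin d) (n : G) (a : A) :
    ‖toPreL2 h.toIsMean (T i n a)‖ = ‖toPreL2 h.toIsMean a‖ := by
  rw [← sq_eq_sq₀ (norm_nonneg _) (norm_nonneg _), norm_toPreL2_sq, norm_toPreL2_sq,
    ← map_star, ← map_mul, h.invariant]

end System

/-! ### Means on bounded families -/

section MeanAlong

open scoped BoundedContinuousFunction

variable {𝕜 A G : Type*} [RCLike 𝕜] [NormedCommRing A] [StarRing A] [NormedAlgebra 𝕜 A]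
variable {φ : A →ₗ[𝕜] 𝕜}

theorem re_finsetAverage (I : Finset G) (u : G → 𝕜) :
    RCLike.re (finsetAverage 𝕜 I u) = finsetAverage ℝ I fun n => RCLike.re (u n) := by
  have h : ((I.card : 𝕜)⁻¹) = (((I.card : ℝ)⁻¹ : ℝ) : 𝕜) := by push_cast; rfl
  simp only [finsetAverage, smul_eq_mul]
  rw [h, RCLike.re_ofReal_mul, map_sum]

variable [TopologicalSpace G]

theorem exists_tendsto_finsetAverage (hφ : IsMean φ) (U : Ultrafilter (Finset G)) (b : G →ᵇ A) :
    ∃ x, Tendsto (fun I => finsetAverage 𝕜 I fun m => φ (b m)) U (𝓝 x) :=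
  U.exists_tendsto_of_norm_le fun _ => norm_finsetAverage_le (norm_nonneg b) fun m =>
    (hφ.norm_le _).trans (b.norm_coe_le_norm m)

/-- The mean on bounded families `G → A` obtained by averaging the mean of the members of the
family over finite subsets of `G` and passing to the limit along an ultrafilter. -/
noncomputable def meanAlong (hφ : IsMean φ) (U : Ultrafilter (Finset G)) : (G →ᵇ A) →ₗ[𝕜] 𝕜 where
  toFun b := (exists_tendsto_finsetAverage hφ U b).choose
  map_add' a b := tendsto_nhds_unique (exists_tendsto_finsetAverage hφ U (a + b)).choose_spec (by
    simpa [finsetAverage_add] using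
      (exists_tendsto_finsetAverage hφ U a).choose_spec.add
        (exists_tendsto_finsetAverage hφ U b).choose_spec)
  map_smul' c a := tendsto_nhds_unique (exists_tendsto_finsetAverage hφ U (c • a)).choose_spec (by
    have := (exists_tendsto_finsetAverage hφ U a).choose_spec.const_smul c
    refine this.congr fun I => ?_
    simp only [← finsetAverage_smul]
    simp)

theorem tendsto_meanAlong (hφ : IsMean φ) (U : Ultrafilter (Finset G)) (b : G →ᵇ A) :
    Tendsto (fun I => finsetAverage 𝕜 I fun m => φ (b m)) U (𝓝 (meanAlong hφ U b)) :=
  (exists_tendsto_finsetAverage hφ U b).choose_spec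

theorem tendsto_re_meanAlong (hφ : IsMean φ) (U : Ultrafilter (Finset G)) (b : G →ᵇ A) :
    Tendsto (fun I => finsetAverage ℝ I fun m => RCLike.re (φ (b m))) U
      (𝓝 (RCLike.re (meanAlong hφ U b))) := by
  simp only [← re_finsetAverage]
  exact (RCLike.continuous_re.tendsto _).comp (tendsto_meanAlong hφ U b)

variable [NormedStarGroup A]

theorem isMean_meanAlong (hφ : IsMean φ) (U : Ultrafilter (Finset G)) :
    IsMean (meanAlong hφ U) where
  map_star a := tendsto_nhds_unique (tendsto_meanAlong hφ U (star a)) (by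
    refine ((RCLike.continuous_conj (K := 𝕜)).tendsto _ |>.comp
      (tendsto_meanAlong hφ U a)).congr fun I => ?_
    simp [finsetAverage, hφ.map_star])
  re_nonneg a := ge_of_tendsto' (tendsto_re_meanAlong hφ U _) fun I => by
    have := finsetAverage_mono (I := I) (u := fun _ => 0)
      (v := fun m => RCLike.re (φ ((star a * a) m))) fun m _ => hφ.re_nonneg (a m)
    simpa [finsetAverage] using this
  mul_le a b := by
    refine le_of_tendsto_of_tendsto' (tendsto_re_meanAlong hφ U _)
      ((tendsto_re_meanAlong hφ U _).const_mul _) fun I => ?_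
    refine (finsetAverage_mono fun m _ => (hφ.mul_le (a m) (b m)).trans ?_).trans_eq
      (finsetAverage_smul I (‖a‖ ^ 2) fun m => RCLike.re (φ ((star b * b) m)))
    have h1 := a.norm_coe_le_norm m
    have h2 := hφ.re_nonneg (b m)
    change _ ≤ ‖a‖ ^ 2 * RCLike.re (φ (star (b m) * b m))
    gcongr
  norm_le a := le_of_tendsto' (tendsto_meanAlong hφ U a).norm fun I =>
    norm_finsetAverage_le (norm_nonneg a) fun m => (hφ.norm_le _).trans (a.norm_coe_le_norm m)

/-- The pointwise extension of a contractive endomorphism of `A` to bounded families. -/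
noncomputable def liftToFamilies [DiscreteTopology G] (S : A →⋆ₐ[𝕜] A) (hS : ∀ a, ‖S a‖ ≤ ‖a‖) :
    (G →ᵇ A) →⋆ₐ[𝕜] (G →ᵇ A) where
  toFun b := BoundedContinuousFunction.ofNormedAddCommGroupDiscrete (fun m => S (b m)) ‖b‖
    fun m => (hS _).trans (b.norm_coe_le_norm m)
  map_one' := by ext m; exact map_one S
  map_mul' a b := by ext m; exact map_mul S (a m) (b m)
  map_zero' := by ext m; exact map_zero S
  map_add' a b := by ext m; exact map_add S (a m) (b m)
  commutes' c := by ext m; exact AlgHomClass.commutes S c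
  map_star' a := by ext m; exact map_star S (a m)

@[simp] theorem liftToFamilies_apply [DiscreteTopology G] (S : A →⋆ₐ[𝕜] A)
    (hS : ∀ a, ‖S a‖ ≤ ‖a‖) (b : G →ᵇ A) (m : G) : liftToFamilies S hS b m = S (b m) := rfl

variable [DiscreteTopology G] [AddCommGroup G] {d : ℕ} {T : Fin d → G → A →⋆ₐ[𝕜] A}

theorem isSystem_meanAlong (h : IsSystem φ T) (U : Ultrafilter (Finset G)) :
    IsSystem (meanAlong h.toIsMean U) (fun i n => liftToFamilies (T i n) (h.norm_map_le i n)) where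
  toIsMean := isMean_meanAlong h.toIsMean U
  apply_zero i a := by ext m; exact h.apply_zero i (a m)
  apply_add i m n a := by ext k; exact h.apply_add i m n (a k)
  comm i j m n a := by ext k; exact h.comm i j m n (a k)
  norm_map_le i n a := (BoundedContinuousFunction.norm_le (norm_nonneg a)).2 fun m =>
    (h.norm_map_le i n _).trans (a.norm_coe_le_norm m)
  invariant i n a := tendsto_nhds_unique (tendsto_meanAlong h.toIsMean U _) (by
    simpa [h.invariant] using tendsto_meanAlong h.toIsMean U a)

theorem multipleAverage_liftToFamilies (h : IsSystem φ T) (f : Fin d → G →ᵇ A) (J : Finset G)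
    (m : G) :
    multipleAverage (𝕜 := 𝕜) (fun i n => liftToFamilies (T i n) (h.norm_map_le i n)) f J m
      = multipleAverage T (fun i => f i m) J := by
  let ev : (G →ᵇ A) →ₐ[𝕜] A :=
    { toFun := fun b => b m
      map_one' := rfl, map_mul' := fun _ _ => rfl, map_zero' := rfl, map_add' := fun _ _ => rfl
      commutes' := fun _ => rfl }
  have hev : ∀ b : G →ᵇ A, b m = ev b := fun _ => rfl
  rw [hev]
  simp only [multipleAverage, map_finsetAverage, map_prod]
  rfl

end MeanAlong

/-! ### Reduction to one action fewer -/

section Step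

open scoped BoundedContinuousFunction

variable {𝕜 A G : Type*} [RCLike 𝕜] [NormedCommRing A] [StarRing A] [NormedAlgebra 𝕜 A]
variable {d : ℕ}

/-- The multiple average as an operator in its first function, the other functions `f` being
fixed. -/
noncomputable def averageOperator (T : Fin (d + 1) → G → A →⋆ₐ[𝕜] A) (f : Fin d → A)
    (I : Finset G) : A →ₗ[𝕜] A where
  toFun a := finsetAverage 𝕜 I fun n => T 0 n a * ∏ i, T i.succ n (f i)
  map_add' a b := by simp only [map_add, add_mul, finsetAverage_add]
  map_smul' c a := by simp only [map_smul, smul_mul_assoc, finsetAverage_smul, RingHom.id_apply]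

variable {T : Fin (d + 1) → G → A →⋆ₐ[𝕜] A} {f : Fin d → A}

theorem averageOperator_apply (I : Finset G) (a : A) :
    averageOperator T f I a = finsetAverage 𝕜 I fun n => T 0 n a * ∏ i, T i.succ n (f i) := rfl

theorem multipleAverage_succ (T : Fin (d + 1) → G → A →⋆ₐ[𝕜] A) (f : Fin (d + 1) → A)
    (I : Finset G) :
    multipleAverage T f I = averageOperator T (fun i => f i.succ) I (f 0) := by
  simp only [multipleAverage, averageOperator_apply, Fin.prod_univ_succ]

variable [AddCommGroup G] {φ : A →ₗ[𝕜] 𝕜}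

/-- The formal adjoint of `averageOperator` for the semi-inner product `φ (star a * b)`. -/
noncomputable def averageAdjoint (T : Fin (d + 1) → G → A →⋆ₐ[𝕜] A) (f : Fin d → A)
    (I : Finset G) (b : A) : A :=
  finsetAverage 𝕜 I fun m => T 0 (-m) (b * star (∏ i, T i.succ m (f i)))

theorem inner_averageOperator [StarModule 𝕜 A] (h : IsSystem φ T) (I : Finset G) (a b : A) :
    inner 𝕜 (toPreL2 h.toIsMean (averageOperator T f I a)) (toPreL2 h.toIsMean b)
      = inner 𝕜 (toPreL2 h.toIsMean a) (toPreL2 h.toIsMean (averageAdjoint T f I b)) := by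
  rw [inner_toPreL2, inner_toPreL2, averageOperator_apply, averageAdjoint, mul_finsetAverage,
    map_finsetAverage]
  have hstar : ∀ u : G → A, star (finsetAverage 𝕜 I u) = finsetAverage 𝕜 I fun n => star (u n) :=
    fun u => by simp [finsetAverage]
  rw [hstar, finsetAverage_mul, map_finsetAverage]
  congr 1
  funext n
  have e : star (T 0 n a * ∏ i, T i.succ n (f i)) * b
      = T 0 n (star a * T 0 (-n) (b * star (∏ i, T i.succ n (f i)))) := by
    rw [map_mul, ← h.apply_add, add_neg_cancel, h.apply_zero, star_mul', map_star]
    ring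
  rw [e, h.invariant]

section NormOne

variable [NormOneClass A]

theorem norm_averageOperator_le (h : IsSystem φ T) (I : Finset G) (a : A) :
    ‖averageOperator T f I a‖ ≤ ‖a‖ * ∏ i, ‖f i‖ :=
  norm_finsetAverage_le (mul_nonneg (norm_nonneg _) (Finset.prod_nonneg fun _ _ => norm_nonneg _))
    fun n => (norm_mul_le _ _).trans <|
      mul_le_mul (h.norm_map_le 0 n a) (h.tail.norm_prod_le f n) (norm_nonneg _) (norm_nonneg _)

theorem norm_toPreL2_averageOperator_le [StarModule 𝕜 A] (h : IsSystem φ T) (I : Finset G)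
    (a : A) :
    ‖toPreL2 h.toIsMean (averageOperator T f I a)‖ ≤ (∏ i, ‖f i‖) * ‖toPreL2 h.toIsMean a‖ := by
  have hC : 0 ≤ ∏ i, ‖f i‖ := Finset.prod_nonneg fun _ _ => norm_nonneg _
  rw [averageOperator_apply, map_finsetAverage]
  refine norm_finsetAverage_le (by positivity) fun n => ?_
  rw [mul_comm]
  refine (norm_toPreL2_mul_le _ _ _).trans ?_
  rw [h.norm_toPreL2_map]
  exact mul_le_mul_of_nonneg_right (h.tail.norm_prod_le f n) (norm_nonneg _)

variable [NormedStarGroup A]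

/-- Up to an error governed by the translation defects of `I`, composing the average over `J` with
the adjoint of the average over `I` produces an average over `m ∈ I` of multiple averages over `J`
for one action fewer. The shift `m ↦ m + n` in the average over `I` is what eliminates `T 0`. -/
theorem norm_averageOperator_averageAdjoint_sub_le (h : IsSystem φ T) (I J : Finset G) (g : A) :
    ‖averageOperator T f J (averageAdjoint T f I g)
      - finsetAverage 𝕜 I fun m => T 0 (-m) g * multipleAverage (fun i => T i.succ)
          (fun i => f i * T 0 (-m) (star (T i.succ m (f i)))) J‖
      ≤ finsetAverage ℝ J fun n =>
          translationDefect (-n) I * (‖g‖ * ∏ i, ‖f i‖) * ∏ i, ‖f i‖ := by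
  set P : G → A := fun n => ∏ i, T i.succ n (f i) with hP
  have hPle : ∀ n, ‖P n‖ ≤ ∏ i, ‖f i‖ := h.tail.norm_prod_le f
  set u : G → G → A := fun n m => T 0 (-m) (g * star (P (m + n))) with hu
  have hule : ∀ n m, ‖u n m‖ ≤ ‖g‖ * ∏ i, ‖f i‖ := fun n m =>
    (h.norm_map_le _ _ _).trans <| (norm_mul_le _ _).trans <| by
      rw [norm_star]
      exact mul_le_mul_of_nonneg_left (hPle _) (norm_nonneg _)
  have h1 : averageOperator T f J (averageAdjoint T f I g)
      = finsetAverage 𝕜 J fun n => (finsetAverage 𝕜 I fun m => u n (-n + m)) * P n := by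
    rw [averageOperator_apply]
    congr 1
    funext n
    rw [averageAdjoint, map_finsetAverage]
    congr 2
    funext m
    rw [← h.apply_add, hu]
    congr 2
    · rw [show -(-n + m) = n + -m by abel]
    · rw [show -n + m + n = m by abel]
  have h2 : (finsetAverage 𝕜 I fun m => T 0 (-m) g * multipleAverage (fun i => T i.succ)
          (fun i => f i * T 0 (-m) (star (T i.succ m (f i)))) J)
      = finsetAverage 𝕜 J fun n => finsetAverage 𝕜 I (u n) * P n := by
    simp only [multipleAverage, mul_finsetAverage, finsetAverage_mul]
    rw [finsetAverage_comm]
    congr 1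
    funext n
    congr 1
    funext m
    have e : ∏ i, T i.succ n (f i * T 0 (-m) (star (T i.succ m (f i))))
        = P n * T 0 (-m) (star (P (m + n))) := by
      simp only [hP, map_mul, Finset.prod_mul_distrib]
      rw [star_prod, map_prod]
      congr 1
      refine Finset.prod_congr rfl fun i _ => ?_
      rw [h.comm, ← map_star, ← h.apply_add, add_comm n m, map_star]
    rw [e, hu]
    simp only [map_mul]
    ring
  rw [h1, h2, ← finsetAverage_sub]
  refine (norm_finsetAverage_le_average J _).trans (finsetAverage_mono fun n _ => ?_)
  rw [← sub_mul]
  refine (norm_mul_le _ _).trans ?_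
  have h3 := norm_finsetAverage_shift_sub_le (𝕜 := 𝕜) I (-n) (hule n)
  exact mul_le_mul h3 (hPle n) (norm_nonneg _)
    ((norm_nonneg _).trans h3)

end NormOne

end Step

/-! ### Induction on the number of actions -/

section Cauchy

open scoped BoundedContinuousFunction

/-- In every system the multiple averages of bounded functions form a Cauchy net in `L²` along the
Følner filter. The induction on the number of actions passes to the system `meanAlong`, which
provides the uniformity over families of functions that the reduction to one action fewer needs.
The group lives in `Type` so that `G →ᵇ A` stays in the universe of `A`. -/
theorem IsSystem.cauchy_multipleAverage {𝕜 : Type*} {G : Type} [RCLike 𝕜] [AddCommGroup G]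
    [TopologicalSpace G] [DiscreteTopology G] {d : ℕ} :
    ∀ {A : Type*} [NormedCommRing A] [StarRing A] [NormedAlgebra 𝕜 A] [StarModule 𝕜 A]
      [NormedStarGroup A] [NormOneClass A] {φ : A →ₗ[𝕜] 𝕜} {T : Fin d → G → A →⋆ₐ[𝕜] A}
      (h : IsSystem φ T) (f : Fin d → A), ∀ ε > 0,
      ∀ᶠ p in foelnerFilter G ×ˢ foelnerFilter G,
        ‖toPreL2 h.toIsMean (multipleAverage T f p.1 - multipleAverage T f p.2)‖ ≤ ε := by
  induction d with
  | zero =>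
    intro A _ _ _ _ _ _ φ T h f ε hε
    have hne : ∀ᶠ I in foelnerFilter G, I.Nonempty := mem_inf_of_left (mem_principal_self _)
    have hone : ∀ I : Finset G, I.Nonempty → multipleAverage T f I = 1 := fun I hI => by
      have : (I.card : 𝕜) ≠ 0 := by exact_mod_cast hI.card_pos.ne'
      simp [multipleAverage, finsetAverage, ← Nat.cast_smul_eq_nsmul 𝕜, smul_smul, this]
    filter_upwards [hne.prod_mk hne] with p hp
    rw [hone _ hp.1, hone _ hp.2, sub_self, map_zero, norm_zero]
    exact hε.le
  | succ d ih =>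
    intro A _ _ _ _ _ _ φ T h f ε hε
    set f' : Fin d → A := fun i => f i.succ with hf'
    have hC : 0 ≤ ∏ i, ‖f' i‖ := Finset.prod_nonneg fun _ _ => norm_nonneg _
    set C := ∏ i, ‖f' i‖
    let ι := toPreL2 h.toIsMean
    let Φ : Finset G → PreL2 h.toIsMean →ₗ[𝕜] PreL2 h.toIsMean := fun I =>
      ι.toLinearMap ∘ₗ averageOperator T f' I ∘ₗ ι.symm.toLinearMap
    let Ψ : Finset G → PreL2 h.toIsMean → PreL2 h.toIsMean := fun I b =>
      ι (averageAdjoint T f' I (ι.symm b))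
    have main := cauchy_of_formal_adjoint_comp (Φ := Φ) (Ψ := Ψ) (l := foelnerFilter G) hC
      (fun I a => norm_toPreL2_averageOperator_le h I (ι.symm a))
      (fun I a b => inner_averageOperator h I (ι.symm a) (ι.symm b)) ?_ (ι (f 0)) ε hε
    · filter_upwards [main] with p hp
      rw [multipleAverage_succ, multipleAverage_succ]
      exact hp
    clear ε hε
    intro a' U hU ε hε
    obtain ⟨a, rfl⟩ := ι.surjective a'
    -- The bounded family to which the induction hypothesis is applied.
    let F : Fin d → G →ᵇ A := fun i =>
      BoundedContinuousFunction.ofNormedAddCommGroupDiscrete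
        (fun m => f' i * T 0 (-m) (star (T i.succ m (f' i)))) (‖f' i‖ * ‖f' i‖) fun m => by
          refine (norm_mul_le _ _).trans (mul_le_mul_of_nonneg_left ?_ (norm_nonneg _))
          refine (h.norm_map_le _ _ _).trans ?_
          rw [norm_star]
          exact h.norm_map_le _ _ _
    set K := ‖a‖ * C with hK
    have hK0 : 0 ≤ K := mul_nonneg (norm_nonneg _) hC
    set δ := ε / (2 * (K + 1)) with hδ
    have hδ0 : 0 < δ := by positivity
    filter_upwards [ih (isSystem_meanAlong h.tail U) F (δ / 2) (by positivity)] with p hp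
    obtain ⟨J, J'⟩ := p
    simp only at hp ⊢
    let D : G → A := fun m => multipleAverage (fun i => T i.succ) (fun i => F i m) J
      - multipleAverage (fun i => T i.succ) (fun i => F i m) J'
    -- The `L²` norm of `D m` is small on average over `m ∈ I`.
    have hD : ∀ᶠ I in (U : Filter (Finset G)), finsetAverage ℝ I (fun m => ‖ι (D m)‖) ≤ δ := by
      let T' : Fin d → G → (G →ᵇ A) →⋆ₐ[𝕜] (G →ᵇ A) := fun i n =>
        liftToFamilies (T i.succ n) (h.norm_map_le i.succ n)
      let b : G →ᵇ A := multipleAverage T' F J - multipleAverage T' F J'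
      have h1 := tendsto_re_meanAlong h.tail.toIsMean U (star b * b)
      rw [← norm_toPreL2_sq (isSystem_meanAlong h.tail U).toIsMean] at h1
      have h2 : ∀ m, (star b * b) m = star (D m) * D m := fun m => by
        simp only [BoundedContinuousFunction.mul_apply, BoundedContinuousFunction.star_apply, b,
          BoundedContinuousFunction.sub_apply, T']
        rw [multipleAverage_liftToFamilies h.tail, multipleAverage_liftToFamilies h.tail]
      simp only [h2, ← norm_toPreL2_sq h.toIsMean] at h1
      have h3 := h1.eventually_lt_const (u := δ ^ 2) (pow_lt_pow_left₀
        (hp.trans_lt (half_lt_self hδ0)) (norm_nonneg _) two_ne_zero)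
      filter_upwards [h3] with I hI
      exact (lt_of_pow_lt_pow_left₀ 2 hδ0.le ((sq_finsetAverage_le _ _).trans_lt hI)).le
    -- The translation defects of `I` vanish along the ultrafilter.
    have herr : ∀ J : Finset G, Tendsto (fun I => (finsetAverage ℝ J fun n =>
        translationDefect (-n) I * (K * C) * C) * ‖ι 1‖) U (𝓝 0) := by
      intro J
      have h1 : Tendsto (fun I => ∑ n ∈ J, translationDefect (-n) I * (K * C) * C) U
          (𝓝 (∑ n ∈ J, 0 * (K * C) * C)) :=
        tendsto_finsetSum _ fun n _ =>
          (((tendsto_translationDefect (-n)).mono_left hU).mul_const _).mul_const _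
      simpa [finsetAverage] using (h1.const_mul ((J.card : ℝ)⁻¹)).mul_const ‖ι 1‖
    have hδ4 : 0 < ε / 4 := by positivity
    filter_upwards [hD, (herr J).eventually_le_const hδ4, (herr J').eventually_le_const hδ4]
      with I hI hJ hJ'
    set g := averageOperator T f' I a with hg
    have hgle : ‖g‖ ≤ K := norm_averageOperator_le h I a
    have happrox : ∀ J : Finset G, ‖ι (averageOperator T f' J (averageAdjoint T f' I g)
        - finsetAverage 𝕜 I fun m => T 0 (-m) g * multipleAverage (fun i => T i.succ)
          (fun i => F i m) J)‖ ≤ (finsetAverage ℝ J fun n =>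
        translationDefect (-n) I * (K * C) * C) * ‖ι 1‖ := fun J => by
      refine (norm_toPreL2_le _ _).trans (mul_le_mul_of_nonneg_right ?_ (norm_nonneg _))
      refine (norm_averageOperator_averageAdjoint_sub_le h I J g).trans
        (finsetAverage_mono fun n _ => ?_)
      have := translationDefect_nonneg (-n) I
      gcongr
    have hmain : ‖ι (finsetAverage 𝕜 I fun m => T 0 (-m) g * D m)‖ ≤ ε / 2 := by
      rw [map_finsetAverage]
      refine (norm_finsetAverage_le_average I _).trans ?_
      have h1 : (finsetAverage ℝ I fun m => ‖ι (T 0 (-m) g * D m)‖)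
          ≤ finsetAverage ℝ I fun m => K • ‖ι (D m)‖ :=
        finsetAverage_mono fun m _ => (norm_toPreL2_mul_le _ _ _).trans <|
          mul_le_mul_of_nonneg_right ((h.norm_map_le _ _ _).trans hgle) (norm_nonneg _)
      rw [finsetAverage_smul, smul_eq_mul] at h1
      refine h1.trans ((mul_le_mul_of_nonneg_left hI hK0).trans ?_)
      calc K * δ ≤ (K + 1) * δ := by gcongr; linarith
        _ = ε / 2 := by rw [hδ]; field_simp
    have hsplit : averageOperator T f' J (averageAdjoint T f' I g)
        - averageOperator T f' J' (averageAdjoint T f' I g)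
        = (averageOperator T f' J (averageAdjoint T f' I g)
            - finsetAverage 𝕜 I fun m => T 0 (-m) g * multipleAverage (fun i => T i.succ)
              (fun i => F i m) J)
          + (finsetAverage 𝕜 I fun m => T 0 (-m) g * D m)
          - (averageOperator T f' J' (averageAdjoint T f' I g)
            - finsetAverage 𝕜 I fun m => T 0 (-m) g * multipleAverage (fun i => T i.succ)
              (fun i => F i m) J') := by
      simp only [D, mul_sub, finsetAverage_sub]
      abel
    change ‖ι (averageOperator T f' J (averageAdjoint T f' I g)
        - averageOperator T f' J' (averageAdjoint T f' I g))‖ ≤ ε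
    rw [hsplit, map_sub, map_add]
    refine (norm_sub_le _ _).trans ?_
    refine (add_le_add_left (norm_add_le _ _) _).trans ?_
    linarith [(happrox J).trans hJ, (happrox J').trans hJ']

end Cauchy

/-! ### Følner sequences -/

section Foelner

open scoped symmDiff

theorem translationDefect_add_singleton {G : Type*} [AddCommGroup G] [DecidableEq G] (g a : G)
    (I : Finset G) : translationDefect g (I + {a}) = translationDefect g I := by
  have hI : ((I + {a} : Finset G) : Set G) = a +ᵥ (I : Set G) := by
    rw [Finset.coe_add, Finset.coe_singleton, add_comm, Set.singleton_add]; rfl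
  unfold translationDefect
  rw [Finset.card_add_singleton, hI, vadd_comm g a, ← Set.vadd_set_symmDiff, Set.ncard_vadd_set]

/-- Translates of the members of a Følner sequence of finite sets are asymptotically invariant. -/
theorem tendsto_foelnerFilter_of_isAddFoelner {G ι : Type*} [AddCommGroup G] [DecidableEq G]
    [MeasurableSpace G] [MeasurableSingletonClass G] {l : Filter ι} {I : ι → Finset G}
    (hI : IsAddFoelner G Measure.count l fun k => (I k : Set G)) (a : ι → G) :
    Tendsto (fun k => I k + {a k}) l (foelnerFilter G) := by
  refine tendsto_inf.2 ⟨tendsto_principal.2 ?_, tendsto_iInf.2 fun g => tendsto_comap_iff.2 ?_⟩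
  · filter_upwards [hI.eventually_meas_ne_zero] with k hk
    have hne : (I k).Nonempty := Finset.nonempty_iff_ne_empty.2 fun h => hk (by simp [h])
    exact hne.add (Finset.singleton_nonempty _)
  · have h1 := (ENNReal.tendsto_toReal ENNReal.zero_ne_top).comp
      (hI.tendsto_meas_vadd_symmDiff g)
    refine h1.congr fun k => ?_
    have hfin : ((g +ᵥ (I k : Set G)) ∆ (I k : Set G)).Finite :=
      ((I k).finite_toSet.vadd_set (a := g)).symmDiff (I k).finite_toSet
    simp only [Function.comp_apply]
    rw [translationDefect_add_singleton, translationDefect, ENNReal.toReal_div,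
      Measure.count_apply_finset, Measure.count_apply_finite _ hfin,
      Set.ncard_eq_toFinset_card _ hfin]
    simp

end Foelner

/-! ### The system of bounded measurable functions -/

section BoundedMeasurable

open scoped BoundedContinuousFunction

/-- The algebra of bounded measurable functions on `X`, with the supremum norm. It is meant for the
discrete topology on `X`, for which boundedness is the only condition expressed by `X →ᵇ 𝕜`. -/
def boundedMeasurable (𝕜 X : Type*) [RCLike 𝕜] [MeasurableSpace X] [TopologicalSpace X] :
    StarSubalgebra 𝕜 (X →ᵇ 𝕜) where
  carrier := {b | Measurable b}
  mul_mem' {a b} ha hb := by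
    have ha' : Measurable a := ha
    have hb' : Measurable b := hb
    exact ha'.mul hb'
  add_mem' {a b} ha hb := by
    have ha' : Measurable a := ha
    have hb' : Measurable b := hb
    exact ha'.add hb'
  algebraMap_mem' c := measurable_const (a := c)
  star_mem' {a} ha := by
    have ha' : Measurable a := ha
    exact RCLike.continuous_conj.measurable.comp ha'

variable {𝕜 X : Type*} [RCLike 𝕜] [MeasurableSpace X] [TopologicalSpace X]

theorem norm_apply_le_of_boundedMeasurable (a : boundedMeasurable 𝕜 X) (x : X) :
    ‖a.1 x‖ ≤ ‖a‖ := a.1.norm_coe_le_norm x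

instance : NormedStarGroup (boundedMeasurable 𝕜 X) where
  norm_star_le a := (norm_star a.1).le

theorem memLp_boundedMeasurable (μ : Measure X) [IsProbabilityMeasure μ] (p : ℝ≥0∞)
    (a : boundedMeasurable 𝕜 X) : MemLp a.1 p μ :=
  (memLp_top_of_bound (Measurable.aestronglyMeasurable a.2) ‖a‖
    (Eventually.of_forall (norm_apply_le_of_boundedMeasurable a))).mono_exponent le_top

theorem integrable_boundedMeasurable (μ : Measure X) [IsProbabilityMeasure μ]
    (a : boundedMeasurable 𝕜 X) : Integrable a.1 μ :=
  memLp_one_iff_integrable.1 (memLp_boundedMeasurable μ 1 a)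

/-- Integration of bounded measurable functions. -/
noncomputable def integralMean (𝕜 : Type*) {X : Type*} [RCLike 𝕜] [MeasurableSpace X]
    [TopologicalSpace X] (μ : Measure X) [IsProbabilityMeasure μ] :
    boundedMeasurable 𝕜 X →ₗ[𝕜] 𝕜 where
  toFun a := ∫ x, a.1 x ∂μ
  map_add' a b := integral_add (integrable_boundedMeasurable μ a) (integrable_boundedMeasurable μ b)
  map_smul' c _ := integral_const_mul c _

theorem integralMean_apply (μ : Measure X) [IsProbabilityMeasure μ] (a : boundedMeasurable 𝕜 X) :
    integralMean 𝕜 μ a = ∫ x, a.1 x ∂μ := rfl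

theorem re_integralMean_star_mul_self (μ : Measure X) [IsProbabilityMeasure μ]
    (a : boundedMeasurable 𝕜 X) :
    RCLike.re (integralMean 𝕜 μ (star a * a)) = ∫ x, ‖a.1 x‖ ^ 2 ∂μ := by
  rw [integralMean_apply, ← integral_re (integrable_boundedMeasurable μ (star a * a))]
  refine integral_congr_ae (Eventually.of_forall fun x => ?_)
  change RCLike.re (starRingEnd 𝕜 (a.1 x) * a.1 x) = _
  rw [RCLike.conj_mul]
  norm_cast

theorem isMean_integralMean (μ : Measure X) [IsProbabilityMeasure μ] :
    IsMean (integralMean 𝕜 μ) where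
  map_star _ := integral_conj
  re_nonneg a := by
    rw [re_integralMean_star_mul_self]
    positivity
  mul_le a b := by
    rw [re_integralMean_star_mul_self, re_integralMean_star_mul_self, ← integral_const_mul]
    refine integral_mono ((memLp_boundedMeasurable μ 2 (a * b)).integrable_norm_pow two_ne_zero)
      (((memLp_boundedMeasurable μ 2 b).integrable_norm_pow two_ne_zero).const_mul _) fun x => ?_
    change ‖a.1 x * b.1 x‖ ^ 2 ≤ ‖a‖ ^ 2 * ‖b.1 x‖ ^ 2
    rw [norm_mul, mul_pow]
    gcongr
    exact (norm_apply_le_of_boundedMeasurable a) x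
  norm_le a := by
    simpa [integralMean_apply] using norm_integral_le_of_norm_le_const (μ := μ)
      (Eventually.of_forall (norm_apply_le_of_boundedMeasurable a))

theorem norm_toLp_eq_norm_toPreL2 (μ : Measure X) [IsProbabilityMeasure μ]
    (a : boundedMeasurable 𝕜 X) :
    ‖(memLp_boundedMeasurable μ 2 a).toLp a.1‖ = ‖toPreL2 (isMean_integralMean (𝕜 := 𝕜) μ) a‖ := by
  rw [← sq_eq_sq₀ (norm_nonneg _) (norm_nonneg _), norm_toPreL2_sq,
    re_integralMean_star_mul_self, ← inner_self_eq_norm_sq (𝕜 := 𝕜), L2.inner_def,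
    ← integral_re (L2.integrable_inner _ _)]
  refine integral_congr_ae ?_
  filter_upwards [(memLp_boundedMeasurable μ 2 a).coeFn_toLp] with x hx
  rw [hx, inner_self_eq_norm_sq]

/-- Composition with a measurable transformation, as an endomorphism of the algebra of bounded
measurable functions. -/
noncomputable def koopman (𝕜 : Type*) {X : Type*} [RCLike 𝕜] [MeasurableSpace X]
    [TopologicalSpace X] [DiscreteTopology X] (S : X → X) (hS : Measurable S) :
    boundedMeasurable 𝕜 X →⋆ₐ[𝕜] boundedMeasurable 𝕜 X where
  toFun a := ⟨a.1.compContinuous ⟨S, continuous_of_discreteTopology⟩,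
    (show Measurable a.1 from a.2).comp hS⟩
  map_one' := rfl
  map_mul' _ _ := rfl
  map_zero' := rfl
  map_add' _ _ := rfl
  commutes' _ := rfl
  map_star' _ := rfl

theorem koopman_apply [DiscreteTopology X] (S : X → X) (hS : Measurable S)
    (a : boundedMeasurable 𝕜 X) (x : X) : (koopman 𝕜 S hS a).1 x = a.1 (S x) := rfl

theorem isSystem_koopman [DiscreteTopology X] {G : Type*} [AddCommGroup G] (μ : Measure X)
    [IsProbabilityMeasure μ] {d : ℕ} {T : Fin d → G → X → X}
    (hT : ∀ i, IsMeasurePreservingAction μ (T i))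
    (hcomm : ∀ i j, i ≠ j → ∀ m n x, T i m (T j n x) = T j n (T i m x)) :
    IsSystem (integralMean 𝕜 μ)
      (fun i n => koopman 𝕜 (T i n) ((hT i).measurePreserving n).measurable) where
  toIsMean := isMean_integralMean μ
  apply_zero i a := by
    ext x
    rw [koopman_apply, (hT i).map_zero]
  apply_add i m n a := by
    ext x
    simp only [koopman_apply]
    rw [add_comm, (hT i).map_add]
  comm i j m n a := by
    ext x
    simp only [koopman_apply]
    by_cases hij : i = j
    · subst hij
      rw [← (hT i).map_add, ← (hT i).map_add, add_comm]
    · rw [hcomm i j hij]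
  norm_map_le i n a := (BoundedContinuousFunction.norm_le (norm_nonneg a)).2 fun x =>
    (norm_apply_le_of_boundedMeasurable a) _
  invariant i n a := by
    have hm := (hT i).measurePreserving n
    rw [integralMean_apply, integralMean_apply]
    conv_rhs => rw [← hm.map_eq]
    exact (integral_map hm.aemeasurable
      (Measurable.aestronglyMeasurable (show Measurable a.1 from a.2))).symm

/-- Every essentially bounded function agrees almost everywhere with a bounded measurable one. -/
theorem MeasureTheory.MemLp.exists_boundedMeasurable [DiscreteTopology X] {μ : Measure X}
    {f : X → 𝕜} (hf : MemLp f ∞ μ) : ∃ a : boundedMeasurable 𝕜 X, f =ᵐ[μ] a.1 := by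
  obtain ⟨g, hg, hfg⟩ := hf.1
  have hgm : Measurable g := hg.measurable
  set C := (eLpNorm f ∞ μ).toReal
  have hC : 0 ≤ C := ENNReal.toReal_nonneg
  have hle : ∀ᵐ x ∂μ, ‖f x‖ ≤ C := by
    have h1 := ae_le_eLpNormEssSup (f := f) (μ := μ)
    have h2 : eLpNorm f ∞ μ ≠ ∞ := hf.2.ne
    filter_upwards [h1] with x hx
    rw [← eLpNorm_exponent_top] at hx
    simpa only [toReal_enorm] using ENNReal.toReal_mono h2 hx
  have hs : MeasurableSet {x | ‖g x‖ ≤ C} := measurableSet_le hgm.norm measurable_const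
  refine ⟨⟨BoundedContinuousFunction.ofNormedAddCommGroupDiscrete
    ({x | ‖g x‖ ≤ C}.indicator g) C fun x => ?_, hgm.indicator hs⟩, ?_⟩
  · by_cases hx : ‖g x‖ ≤ C
    · rwa [Set.indicator_of_mem (show x ∈ {x | ‖g x‖ ≤ C} from hx)]
    · rwa [Set.indicator_of_notMem (show x ∉ {x | ‖g x‖ ≤ C} from hx), norm_zero]
  · filter_upwards [hfg, hle] with x h1 h2
    rw [h1] at h2
    change f x = {x | ‖g x‖ ≤ C}.indicator g x
    simp [Set.indicator, h2, h1]

theorem multipleAverage_koopman_apply [DiscreteTopology X] {G : Type*} {d : ℕ}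
    {T : Fin d → G → X → X} (hT : ∀ i n, Measurable (T i n)) (g : Fin d → boundedMeasurable 𝕜 X)
    (I : Finset G) (x : X) :
    (multipleAverage (fun i n => koopman 𝕜 (T i n) (hT i n)) g I).1 x
      = (I.card : 𝕜)⁻¹ * ∑ n ∈ I, ∏ i, (g i).1 (T i n x) := by
  let ev : boundedMeasurable 𝕜 X →ₐ[𝕜] 𝕜 :=
    { toFun := fun b => b.1 x
      map_one' := rfl, map_mul' := fun _ _ => rfl, map_zero' := rfl, map_add' := fun _ _ => rfl
      commutes' := fun _ => rfl }
  have hev : ∀ b : boundedMeasurable 𝕜 X, b.1 x = ev b := fun _ => rfl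
  rw [hev]
  simp only [multipleAverage, map_finsetAverage, map_prod]
  rfl

end BoundedMeasurable

/-! ### Convergence of the nonconventional averages -/

theorem theorem1p1 {𝕜 : Type*} [RCLike 𝕜] {X : Type*} [MeasurableSpace X] [StandardBorelSpace X]
    (μ : Measure X) [IsProbabilityMeasure μ] (r d : ℕ)
    (T : Fin d → (Fin r → ℤ) → X → X)
    (hT : ∀ i, IsMeasurePreservingAction μ (T i))
    (hcomm : ∀ i j, i ≠ j → ∀ m n x, T i m (T j n x) = T j n (T i m x))
    (f : Fin d → X → 𝕜) (hf : ∀ i, MemLp (f i) ∞ μ) :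
    ∃ F : X → 𝕜, MemLp F 2 μ ∧
      ∀ (I : ℕ → Finset (Fin r → ℤ)) (a : ℕ → Fin r → ℤ),
        IsAddFoelner (Fin r → ℤ) Measure.count atTop (fun N => (I N : Set (Fin r → ℤ))) →
        Tendsto (fun N => eLpNorm (nonconventionalAverage T f (I N) (a N) - F) 2 μ)
          atTop (𝓝 0) := by
  -- The discrete topology makes `X →ᵇ 𝕜` the space of all bounded functions.
  let _ : TopologicalSpace X := ⊥
  have : DiscreteTopology X := ⟨rfl⟩
  have : Nonempty X := μ.nonempty_of_neZero
  choose g hg using fun i => (hf i).exists_boundedMeasurable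
  have hsys := isSystem_koopman (𝕜 := 𝕜) μ hT hcomm
  let avg : Finset (Fin r → ℤ) → boundedMeasurable 𝕜 X := multipleAverage
    (fun i n => koopman 𝕜 (T i n) ((hT i).measurePreserving n).measurable) g
  let v : Finset (Fin r → ℤ) → Lp 𝕜 2 μ := fun I =>
    (memLp_boundedMeasurable μ 2 (avg I)).toLp (avg I).1
  have hlim : ∃ F : Lp 𝕜 2 μ, Tendsto v (foelnerFilter (Fin r → ℤ)) (𝓝 F) := by
    -- If the filter were trivial, there would be no Følner sequence, and any `F` would do. Boxes show
    -- that it is not, but this is not needed.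
    rcases (foelnerFilter (Fin r → ℤ)).eq_or_neBot with h | h
    · exact ⟨0, by rw [h]; exact tendsto_bot⟩
    refine CompleteSpace.complete (cauchy_map_iff.2 ⟨h, ?_⟩)
    refine Metric.uniformity_basis_dist_le.tendsto_right_iff.2 fun ε hε => ?_
    filter_upwards [hsys.cauchy_multipleAverage g ε hε] with p hp
    change dist (v p.1) (v p.2) ≤ ε
    rw [dist_eq_norm]
    have e : v p.1 - v p.2 =
        (memLp_boundedMeasurable μ 2 (avg p.1 - avg p.2)).toLp (avg p.1 - avg p.2).1 :=
      (MemLp.toLp_sub _ _).symm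
    rw [e, norm_toLp_eq_norm_toPreL2]
    exact hp
  obtain ⟨F, hF⟩ := hlim
  refine ⟨F, Lp.memLp F, fun I a hI => ?_⟩
  have h1 := hF.comp (tendsto_foelnerFilter_of_isAddFoelner hI a)
  rw [tendsto_iff_edist_tendsto_0] at h1
  refine h1.congr fun N => ?_
  rw [Function.comp_apply, Lp.edist_def]
  refine eLpNorm_congr_ae ?_
  have hae : ∀ᵐ x ∂μ, ∀ n ∈ I N + {a N}, ∀ i, f i (T i n x) = (g i).1 (T i n x) :=
    (ae_ball_iff (Finset.countable_toSet _)).2 fun n _ => ae_all_iff.2 fun i =>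
      ((hT i).measurePreserving n).quasiMeasurePreserving.ae (hg i)
  filter_upwards [(memLp_boundedMeasurable μ 2 (avg (I N + {a N}))).coeFn_toLp, hae] with x hx hx'
  simp only [Pi.sub_apply, v]
  rw [hx, multipleAverage_koopman_apply, nonconventionalAverage]
  rw [Finset.card_add_singleton]
  congr 2
  exact Finset.sum_congr rfl fun n hn => Finset.prod_congr rfl fun i _ => (hx' n hn i).symm
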